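/- Let $\mathbb{C}^+=\{z=x+is: x\in\mathbb{R},\ s>0\}$ be the upper half plane, and for $z\in\mathbb{C}^+$, $R>0$ let $$\mathcal{D}_R(z)=\Big\{w\in\mathbb{C}^+:\ \Big|\frac{z-w}{z-\overline{w}}\Big|<R\Big\}$$ be the pseudohyperbolic disk of radius $R$ centred at $z$. Let $\alpha>0$, and let $\mathcal{A}_\alpha(\mathbb{C}^+)$ be the space of holomorphic functions $F$ on $\mathbb{C}^+$ with $$\|F\|_{\mathcal{A}_\alpha}^2:=\int_{\mathbb{C}^+}|F(z)|^2 s^\alpha\,dz<\infty,$$ where $s=\operatorname{Im} z$ and $dz$ is the two-dimensional Lebesgue measure. Let $\mu$ be a (Borel) measure on $\mathbb{C}^+$ that is a sampling measure for $\mathcal{A}_\alpha(\mathbb{C}^+)$ with constants $A,B>0$, that is, $$A\|F\|_{\mathcal{A}_\alpha}^2\le\int_{\mathbb{C}^+}|F(z)|^2 s^\alpha\,d\mu(z)\le B\|F\|_{\mathcal{A}_\alpha}^2\qquad\text{for all }F\in\mathcal{A}_\alpha(\mathbb{C}^+).$$ If $R>0$ and $\mu(\mathcal{D}_R(z))=0$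 for some $z\in\mathbb{C}^+$, then $$R\le 1-\Big(\frac{1}{4^{\alpha+1}\pi}\,\frac{A}{B}\Big)^{1/\alpha}.$$ -/

import Mathlib

open MeasureTheory UpperHalfPlane

noncomputable section

namespace BergmanSampling

/-- The pseudohyperbolic metric `ρ(z, w) = |(z - w) / (z - conj w)|` on the upper half plane. -/
def pseudoHypDist (z w : ℂ) : ℝ :=
  ‖(z - w) / (z - (starRingEnd ℂ) w)‖

/-- The pseudohyperbolic disk of radius `R` centred at `z`, a subset of the upper half plane. -/
def pseudoHypDisk (z : ℂ) (R : ℝ) : Set ℂ :=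
  {w | w ∈ upperHalfPlaneSet ∧ pseudoHypDist z w < R}

/-- The integral `∫ |F(z)|² s ^ α dμ(z)` over the upper half plane, where `s = Im z`,
as an extended nonnegative number. Only the part of `μ` on the upper half plane matters. -/
def weightedIntegral (α : ℝ) (μ : Measure ℂ) (F : ℂ → ℂ) : ENNReal :=
  ∫⁻ z in upperHalfPlaneSet, ENNReal.ofReal (‖F z‖ ^ 2 * z.im ^ α) ∂μ

/-- The squared norm of the weighted Bergman space: the integral against Lebesgue measure. -/
def bergmanNormSq (α : ℝ) (F : ℂ → ℂ) : ENNReal :=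
  weightedIntegral α volume F

/-- Membership in the weighted Bergman space: `F` is holomorphic on the upper half plane and has
finite norm. The values of `F` off the upper half plane play no role. -/
structure MemBergman (α : ℝ) (F : ℂ → ℂ) : Prop where
  holomorphic : DifferentiableOn ℂ F upperHalfPlaneSet
  norm_lt_top : bergmanNormSq α F < ⊤

/-- `μ` is a sampling measure for the weighted Bergman space, with sampling constants `A`, `B`. -/
structure IsSamplingMeasure (α : ℝ) (μ : Measure ℂ) (A B : ℝ) : Prop where
  lower_pos : 0 < A
  upper_pos : 0 < B
  lower : ∀ F : ℂ → ℂ, MemBergman α F →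
    ENNReal.ofReal A * bergmanNormSq α F ≤ weightedIntegral α μ F
  upper : ∀ F : ℂ → ℂ, MemBergman α F →
    weightedIntegral α μ F ≤ ENNReal.ofReal B * bergmanNormSq α F

end BergmanSampling

end

noncomputable section

namespace BergmanSampling

open Set ComplexConjugate

/-! Let φ be the Cayley map taking z to 0. The functions `φⁿ (w - conj z)^(-(α+2))` are the
monomials ζⁿ of the weighted disk space, so their squared norms are one common constant times
`radialMoment α n`. Since |φ| ≥ R holds μ-almost everywhere on the half plane, passing from degree 0
to degree n shrinks the μ-integral by at most R²ⁿ. The lower sampling bound at degree 0 and the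
upper one at degree n then give A R²ⁿ m₀ ≤ B mₙ (`IsSamplingMeasure.radialMoment_le`).

For R < 1, taking n of order (α+1)/(1-R) keeps R²ⁿ bounded below in terms of α alone, while mₙ is of
order (1-R)^α m₀ (`exists_radialMoment_le`). Hence A/B ≤ 4^(α+1) π (1-R)^α. -/

/-- The lower integral of the nonnegative derivative of a continuous function. -/
lemma lintegral_Ioo_of_hasDerivAt {a b : ℝ} (hab : a ≤ b) {g g' : ℝ → ℝ}
    (hcont : ContinuousOn g (Icc a b)) (hderiv : ∀ x ∈ Ioo a b, HasDerivAt g (g' x) x)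
    (hnonneg : ∀ x ∈ Ioo a b, 0 ≤ g' x) :
    ∫⁻ x in Ioo a b, ENNReal.ofReal (g' x) = ENNReal.ofReal (g b - g a) := by
  have hint := intervalIntegral.integrableOn_deriv_of_nonneg hcont hderiv hnonneg
  have hint' : IntegrableOn g' (Ioo a b) := hint.mono_set Ioo_subset_Ioc_self
  rw [← ofReal_integral_eq_lintegral_ofReal hint'
    (ae_restrict_of_forall_mem measurableSet_Ioo hnonneg)]
  rw [← integral_Ioc_eq_integral_Ioo, ← intervalIntegral.integral_of_le hab,
    intervalIntegral.integral_eq_sub_of_hasDerivAt_of_le hab hcont hderiv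
      ((intervalIntegrable_iff_integrableOn_Ioc_of_le hab).2 hint)]

/-! ### Radial moments on the disk and the choice of degree -/

/-- The radial integral `∫₀¹ r · r²ⁿ (1 - r²) ^ α dr`. -/
def radialMoment (α : ℝ) (n : ℕ) : ENNReal :=
  ∫⁻ r in Ioo (0 : ℝ) 1, ENNReal.ofReal (r * ((r ^ 2) ^ n * (1 - r ^ 2) ^ α))

lemma radialMoment_zero {α : ℝ} (hα : 0 < α) :
    radialMoment α 0 = ENNReal.ofReal (1 / (2 * (α + 1))) := by
  have h := lintegral_Ioo_of_hasDerivAt (a := 0) (b := 1) zero_le_one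
    (g := fun r : ℝ => -((1 - r ^ 2) ^ (α + 1) / (2 * (α + 1))))
    (g' := fun r : ℝ => r * ((r ^ 2) ^ 0 * (1 - r ^ 2) ^ α)) ?_ ?_ ?_
  · rw [radialMoment, h]
    congr 1
    norm_num [Real.zero_rpow (by linarith : α + 1 ≠ 0)]
  · have : Continuous fun r : ℝ => (1 - r ^ 2) ^ (α + 1) :=
      (by fun_prop : Continuous fun r : ℝ => 1 - r ^ 2).rpow_const fun _ => Or.inr (by linarith)
    exact (this.div_const _).neg.continuousOn
  · intro r hr
    have hpos : 0 < 1 - r ^ 2 := by nlinarith [hr.1, hr.2]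
    have h1 : HasDerivAt (fun r : ℝ => 1 - r ^ 2) (-(2 * r)) r := by
      simpa using (hasDerivAt_pow 2 r).const_sub 1
    have h2 := ((h1.rpow_const (p := α + 1) (Or.inl hpos.ne')).div_const (2 * (α + 1))).neg
    refine h2.congr_deriv ?_
    have : α + 1 ≠ 0 := by linarith
    rw [add_sub_cancel_right]
    field_simp
  · intro r hr
    have hpos : 0 < 1 - r ^ 2 := by nlinarith [hr.1, hr.2]
    have := hr.1
    positivity

/-- This is t e^(-t) ≤ e^(-1) at t = y/c, raised to the power α; equality holds at y = c. -/
lemma rpow_mul_exp_neg_le {α c y : ℝ} (hα : 0 < α) (hc : 0 < c) (hy : 0 ≤ y) :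
    y ^ α * Real.exp (-(α * (y / c))) ≤ c ^ α * Real.exp (-α) := by
  have h := Real.mul_exp_neg_le_exp_neg_one (y / c)
  have h0 : 0 ≤ y / c * Real.exp (-(y / c)) := by positivity
  have h1 := Real.rpow_le_rpow h0 h hα.le
  rw [Real.mul_rpow (by positivity) (by positivity), ← Real.exp_mul, ← Real.exp_mul,
    Real.div_rpow hy hc.le, div_mul_eq_mul_div, div_le_iff₀ (by positivity)] at h1
  calc _ = y ^ α * Real.exp (-(y / c) * α) := by ring_nf
    _ ≤ _ := h1
    _ = _ := by ring_nf

/-- Bound xⁿ by e^(-n(1-x)) and split the exponent: two thirds absorb the factor (1-x)^α, and one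
third is kept to make the radial integral of size 3/(2n). -/
lemma pow_mul_rpow_le {α c x : ℝ} {n : ℕ} (hα : 0 < α) (hc : 0 < c) (hn : 3 * α ≤ 2 * n * c)
    (hx0 : 0 ≤ x) (hx1 : x ≤ 1) :
    x ^ n * (1 - x) ^ α ≤ c ^ α * Real.exp (-α) * Real.exp (-(n / 3 * (1 - x))) := by
  have hy : 0 ≤ 1 - x := by linarith
  have h1 : x ^ n ≤ Real.exp (-(n * (1 - x))) := by
    have : x ≤ Real.exp (-(1 - x)) := by linarith [Real.add_one_le_exp (-(1 - x))]
    calc x ^ n ≤ Real.exp (-(1 - x)) ^ n := by gcongr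
      _ = _ := by rw [← Real.exp_nat_mul]; ring_nf
  have h2 : Real.exp (-(n * (1 - x))) ≤
      Real.exp (-(α * ((1 - x) / c))) * Real.exp (-(n / 3 * (1 - x))) := by
    rw [← Real.exp_add]
    apply Real.exp_le_exp.2
    have h3 : α * ((1 - x) / c) ≤ 2 * n / 3 * (1 - x) := by
      rw [mul_div_assoc', div_le_iff₀ hc]
      nlinarith
    linarith
  calc x ^ n * (1 - x) ^ α
      ≤ (Real.exp (-(α * ((1 - x) / c))) * Real.exp (-(n / 3 * (1 - x)))) * (1 - x) ^ α := by
        gcongr; exact h1.trans h2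
    _ = ((1 - x) ^ α * Real.exp (-(α * ((1 - x) / c)))) * Real.exp (-(n / 3 * (1 - x))) := by ring
    _ ≤ _ := mul_le_mul_of_nonneg_right (rpow_mul_exp_neg_le hα hc hy) (Real.exp_nonneg _)

lemma radialMoment_le {α c : ℝ} {n : ℕ} (hα : 0 < α) (hc : 0 < c) (hn0 : n ≠ 0)
    (hn : 3 * α ≤ 2 * n * c) :
    radialMoment α n ≤ ENNReal.ofReal (c ^ α * Real.exp (-α) * (3 / (2 * n))) := by
  have hnpos : (0 : ℝ) < n := by positivity
  set M := c ^ α * Real.exp (-α) with hM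
  have hMpos : 0 < M := by positivity
  have h := lintegral_Ioo_of_hasDerivAt (a := 0) (b := 1) zero_le_one
    (g := fun r : ℝ => M * (3 / (2 * n)) * Real.exp (-(n / 3 * (1 - r ^ 2))))
    (g' := fun r : ℝ => r * (M * Real.exp (-(n / 3 * (1 - r ^ 2))))) ?_ ?_ ?_
  · calc radialMoment α n
        ≤ ∫⁻ r in Ioo (0 : ℝ) 1,
            ENNReal.ofReal (r * (M * Real.exp (-(n / 3 * (1 - r ^ 2))))) := by
          refine setLIntegral_mono' measurableSet_Ioo fun r hr => ENNReal.ofReal_le_ofReal ?_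
          refine mul_le_mul_of_nonneg_left ?_ hr.1.le
          exact pow_mul_rpow_le hα hc hn (sq_nonneg r) (by nlinarith [hr.1, hr.2])
      _ = _ := h
      _ ≤ _ := by
          apply ENNReal.ofReal_le_ofReal
          have : 0 ≤ M * (3 / (2 * n)) * Real.exp (-(n / 3 * (1 - (0 : ℝ) ^ 2))) := by positivity
          simp only [one_pow, sub_self, mul_zero, neg_zero, Real.exp_zero, mul_one]
          linarith
  · fun_prop
  · intro r _
    have h1 : HasDerivAt (fun r : ℝ => -(n / 3 * (1 - r ^ 2))) (-(n / 3 * (-(2 * r)))) r := by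
      have : HasDerivAt (fun r : ℝ => 1 - r ^ 2) (-(2 * r)) r := by
        simpa using (hasDerivAt_pow 2 r).const_sub 1
      exact (this.const_mul _).neg
    refine (h1.exp.const_mul (M * (3 / (2 * n)))).congr_deriv ?_
    field_simp
  · intro r hr
    have := hr.1
    positivity

lemma radialMoment_lt_top {α : ℝ} (hα : 0 < α) (n : ℕ) : radialMoment α n < ⊤ := by
  refine lt_of_le_of_lt ?_ ((radialMoment_zero hα).le.trans_lt ENNReal.ofReal_lt_top)
  refine setLIntegral_mono' measurableSet_Ioo fun r hr => ENNReal.ofReal_le_ofReal ?_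
  have hpos : 0 < 1 - r ^ 2 := by nlinarith [hr.1, hr.2]
  have h1 : (r ^ 2) ^ n ≤ (r ^ 2) ^ 0 := pow_le_pow_of_le_one (sq_nonneg r) (by linarith) n.zero_le
  have := hr.1.le
  gcongr

/-- A monomial whose radial moment beats its decay on the disk of radius `R`. -/
lemma exists_radialMoment_le {α R : ℝ} (hα : 0 < α) (hR : 0 < R) (hR1 : R < 1) :
    ∃ n : ℕ, radialMoment α n ≤ ENNReal.ofReal
      ((4 : ℝ) ^ (α + 1) * Real.pi * (1 - R) ^ α * (R ^ 2) ^ n / (2 * (α + 1))) := by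
  set d := 1 - R with hd
  have hd0 : 0 < d := by linarith
  have h4 : (4 : ℝ) ^ (α + 1) * Real.pi * d ^ α = 4 * Real.pi * (4 * d) ^ α := by
    rw [Real.rpow_add (by norm_num), Real.rpow_one, Real.mul_rpow (by norm_num) hd0.le]
    ring
  rw [h4]
  have hpi := Real.pi_gt_three
  rcases le_or_gt (1 / 4) d with hd4 | hd4
  -- When 4d ≥ 1 the claimed bound exceeds m₀ itself.
  · refine ⟨0, ?_⟩
    rw [radialMoment_zero hα]
    apply ENNReal.ofReal_le_ofReal
    rw [pow_zero, mul_one]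
    have : 1 ≤ (4 * d) ^ α := Real.one_le_rpow (by linarith) hα.le
    gcongr
    nlinarith
  -- With this t, n ≥ t gives 8nd ≥ 3(α+1), as the moment bound with c = 4d needs, and n < t + 1
  -- gives 8nd/3 ≤ α + 5/3, which controls R^(-2n).
  · set t := 3 * (α + 1) / (8 * d) with ht
    have htpos : 0 < t := by positivity
    refine ⟨⌈t⌉₊, ?_⟩
    set n := ⌈t⌉₊ with hn
    have hn0 : n ≠ 0 := (Nat.ceil_pos.2 htpos).ne'
    have hnpos : (0 : ℝ) < n := by positivity
    have hle : t ≤ n := Nat.le_ceil t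
    have hlt : n < t + 1 := Nat.ceil_lt_add_one htpos.le
    have htd : t * d = 3 * (α + 1) / 8 := by rw [ht]; field_simp
    have hnd : 3 * (α + 1) / 8 ≤ n * d := by nlinarith
    refine (radialMoment_le (c := 4 * d) hα (by positivity) hn0 (by nlinarith)).trans ?_
    apply ENNReal.ofReal_le_ofReal
    have hRinv : 1 / R ≤ Real.exp (4 / 3 * d) := by
      have h1 : 1 / R ≤ 4 / 3 * d + 1 := by
        rw [div_le_iff₀ hR]
        have : R = 1 - d := by rw [hd]; ring
        rw [this]
        nlinarith
      exact h1.trans (Real.add_one_le_exp _)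
    have hRpow : 1 ≤ (R ^ 2) ^ n * Real.exp (α + 5 / 3) := by
      have h1 : (1 / R) ^ (2 * n) ≤ Real.exp (α + 5 / 3) := by
        calc (1 / R) ^ (2 * n) ≤ Real.exp (4 / 3 * d) ^ (2 * n) := by gcongr
          _ = Real.exp ((2 * n : ℕ) * (4 / 3 * d)) := by rw [← Real.exp_nat_mul]
          _ ≤ _ := by
            apply Real.exp_le_exp.2
            push_cast
            nlinarith
      rw [one_div, inv_pow, inv_le_iff_one_le_mul₀ (by positivity), pow_mul] at h1
      linarith
    have he : Real.exp (5 / 3) ≤ 6 := by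
      have h1 : Real.exp (5 / 3) ^ 3 ≤ 6 ^ 3 := by
        have h5 : Real.exp (5 / 3) ^ 3 = Real.exp 1 ^ 5 := by
          rw [← Real.exp_nat_mul, ← Real.exp_nat_mul]; norm_num
        rw [h5]
        calc Real.exp 1 ^ 5 ≤ (2.72 : ℝ) ^ 5 := by
              gcongr; linarith [Real.exp_one_lt_d9]
          _ ≤ 6 ^ 3 := by norm_num
      exact le_of_pow_le_pow_left₀ (by norm_num) (by norm_num) h1
    -- Here d < 1/4 enters: n ≥ t ≥ 3(α+1)/2.
    have h3 : 3 / (2 * (n : ℝ)) ≤ 1 / (α + 1) := by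
      rw [div_le_div_iff₀ (by positivity) (by positivity)]
      nlinarith
    rw [Real.exp_add] at hRpow
    have hea : Real.exp (-α) ≤ (R ^ 2) ^ n * 6 := by
      rw [Real.exp_neg, inv_le_iff_one_le_mul₀ (by positivity)]
      have : (R ^ 2) ^ n * (Real.exp α * Real.exp (5 / 3)) ≤ (R ^ 2) ^ n * (Real.exp α * 6) := by
        gcongr
      linarith
    calc (4 * d) ^ α * Real.exp (-α) * (3 / (2 * n))
        ≤ (4 * d) ^ α * ((R ^ 2) ^ n * 6) * (1 / (α + 1)) := by gcongr
      _ = 12 * (4 * d) ^ α * (R ^ 2) ^ n / (2 * (α + 1)) := by field_simp; norm_num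
      -- The slack is 12 ≤ 4π.
      _ ≤ _ := by gcongr; linarith


/-! ### Cayley transform and change of variables -/

lemma sub_conj_ne_zero {z w : ℂ} (hz : 0 < z.im) (hw : 0 < w.im) : w - conj z ≠ 0 := by
  intro h
  have := congrArg Complex.im h
  simp at this
  linarith

lemma normSq_sub_conj (z w : ℂ) :
    ‖w - conj z‖ ^ 2 = ‖w - z‖ ^ 2 + 4 * z.im * w.im := by
  rw [← Complex.normSq_eq_norm_sq, ← Complex.normSq_eq_norm_sq, Complex.normSq_apply,
    Complex.normSq_apply]
  simp
  ring

/-- The Cayley transform sending the point `z` of the upper half plane to the origin. -/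
def cayley (z w : ℂ) : ℂ := (w - z) / (w - conj z)

lemma norm_cayley (z w : ℂ) : ‖cayley z w‖ = pseudoHypDist z w := by
  have h : ‖w - conj z‖ = ‖z - conj w‖ := by
    rw [← Complex.norm_conj, map_sub, Complex.conj_conj, norm_sub_rev]
  rw [cayley, pseudoHypDist, norm_div, norm_div, norm_sub_rev, h]

lemma one_sub_norm_cayley_sq {z w : ℂ} (hz : 0 < z.im) (hw : 0 < w.im) :
    1 - ‖cayley z w‖ ^ 2 = 4 * z.im * w.im / ‖w - conj z‖ ^ 2 := by
  have h : ‖w - conj z‖ ≠ 0 := norm_ne_zero_iff.2 (sub_conj_ne_zero hz hw)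
  have := normSq_sub_conj z w
  rw [cayley, norm_div]
  field_simp
  linarith

lemma norm_cayley_lt_one {z w : ℂ} (hz : 0 < z.im) (hw : 0 < w.im) : ‖cayley z w‖ < 1 := by
  have h : ‖w - conj z‖ ≠ 0 := norm_ne_zero_iff.2 (sub_conj_ne_zero hz hw)
  have h1 := one_sub_norm_cayley_sq hz hw
  have h2 : 0 < 4 * z.im * w.im / ‖w - conj z‖ ^ 2 := by positivity
  nlinarith [norm_nonneg (cayley z w)]

lemma hasDerivAt_cayley {z w : ℂ} (hz : 0 < z.im) (hw : 0 < w.im) :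
    HasDerivAt (cayley z) ((z - conj z) / (w - conj z) ^ 2) w := by
  have h := sub_conj_ne_zero hz hw
  have := ((hasDerivAt_id w).sub_const z).div ((hasDerivAt_id w).sub_const (conj z)) h
  refine this.congr_deriv ?_
  simp only [id]
  congr 1
  ring

lemma sub_conj_mul_one_sub_cayley {z w : ℂ} (hz : 0 < z.im) (hw : 0 < w.im) :
    (w - conj z) * (1 - cayley z w) = z - conj z := by
  have h := sub_conj_ne_zero hz hw
  rw [cayley]
  field_simp
  ring

lemma injOn_cayley {z : ℂ} (hz : 0 < z.im) : InjOn (cayley z) upperHalfPlaneSet := by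
  intro w hw w' hw' h
  have h1 := sub_conj_mul_one_sub_cayley hz hw
  have h2 := sub_conj_mul_one_sub_cayley hz hw'
  have hne : 1 - cayley z w' ≠ 0 := by
    intro h0
    rw [h0, mul_zero] at h2
    exact sub_conj_ne_zero hz hz h2.symm
  rw [h] at h1
  exact sub_left_injective (mul_right_cancel₀ hne (h1.trans h2.symm))

lemma image_cayley {z : ℂ} (hz : 0 < z.im) :
    cayley z '' upperHalfPlaneSet = Metric.ball 0 1 := by
  ext ζ
  rw [mem_ball_zero_iff]
  constructor
  · rintro ⟨w, hw, rfl⟩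
    exact norm_cayley_lt_one hz hw
  · intro hζ
    have hne : 1 - ζ ≠ 0 := by
      intro h
      rw [← sub_eq_zero.1 h] at hζ
      simp at hζ
    have hzz := sub_conj_ne_zero hz hz
    have h1 : (z - conj z * ζ) / (1 - ζ) - conj z = (z - conj z) / (1 - ζ) := by
      field_simp; ring
    have h2 : (z - conj z * ζ) / (1 - ζ) - z = ζ * (z - conj z) / (1 - ζ) := by
      field_simp; ring
    refine ⟨(z - conj z * ζ) / (1 - ζ), ?_, ?_⟩
    · change 0 < ((z - conj z * ζ) / (1 - ζ)).im
      have hpos : 0 < Complex.normSq (1 - ζ) := Complex.normSq_pos.2 hne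
      have : ((z - conj z * ζ) / (1 - ζ)).im =
          z.im * (1 - ‖ζ‖ ^ 2) / Complex.normSq (1 - ζ) := by
        rw [← Complex.normSq_eq_norm_sq, Complex.div_im, ← sub_div]
        congr 1
        simp [Complex.normSq_apply]
        ring
      rw [this]
      have : 0 < 1 - ‖ζ‖ ^ 2 := by nlinarith [norm_nonneg ζ]
      positivity
    · rw [cayley, h1, h2]
      field_simp

lemma abs_det_restrictScalars_toSpanSingleton (a : ℂ) :
    |((ContinuousLinearMap.toSpanSingleton ℂ a).restrictScalars ℝ).det| = ‖a‖ ^ 2 := by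
  rw [ContinuousLinearMap.det]
  have : ((((ContinuousLinearMap.toSpanSingleton ℂ a).restrictScalars ℝ : ℂ →L[ℝ] ℂ)) :
      ℂ →ₗ[ℝ] ℂ) = ((ContinuousLinearMap.toSpanSingleton ℂ a : ℂ →ₗ[ℂ] ℂ)).restrictScalars ℝ := rfl
  rw [this, LinearMap.det_restrictScalars]
  simp [Algebra.norm_complex_eq, Complex.normSq_eq_norm_sq]

lemma lintegral_comp_cayley {z : ℂ} (hz : 0 < z.im) (g : ℂ → ENNReal) :
    ∫⁻ w in upperHalfPlaneSet,
      ENNReal.ofReal (‖(z - conj z) / (w - conj z) ^ 2‖ ^ 2) * g (cayley z w) =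
    ∫⁻ ζ in Metric.ball 0 1, g ζ := by
  rw [← image_cayley hz, lintegral_image_eq_lintegral_abs_det_fderiv_mul volume
    isOpen_upperHalfPlaneSet.measurableSet
    (fun w hw => ((hasDerivAt_cayley hz hw).hasFDerivAt.restrictScalars ℝ).hasFDerivWithinAt)
    (injOn_cayley hz) g]
  refine setLIntegral_congr_fun isOpen_upperHalfPlaneSet.measurableSet fun w hw => ?_
  simp only [abs_det_restrictScalars_toSpanSingleton]

lemma lintegral_ball_norm {g : ℝ → ENNReal} (hg : Measurable g) :
    ∫⁻ ζ in Metric.ball (0 : ℂ) 1, g ‖ζ‖ =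
      ENNReal.ofReal (2 * Real.pi) * ∫⁻ r in Ioo (0 : ℝ) 1, ENNReal.ofReal r * g r := by
  rw [← lintegral_indicator Metric.isOpen_ball.measurableSet,
    ← Complex.lintegral_comp_polarCoord_symm]
  have hmeas : Measurable fun r : ℝ => ENNReal.ofReal r * (Iio (1 : ℝ)).indicator g r :=
    (by fun_prop : Measurable ENNReal.ofReal).mul (hg.indicator measurableSet_Iio)
  have h1 : ∀ p ∈ polarCoord.target,
      ENNReal.ofReal p.1 • (Metric.ball (0 : ℂ) 1).indicator (fun ζ => g ‖ζ‖)
        (Complex.polarCoord.symm p) = ENNReal.ofReal p.1 * (Iio (1 : ℝ)).indicator g p.1 := by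
    intro p hp
    have hp1 : 0 < p.1 := by
      rw [polarCoord_target] at hp
      exact hp.1
    simp [indicator, abs_of_pos hp1]
  rw [setLIntegral_congr_fun polarCoord.open_target.measurableSet h1, polarCoord_target,
    Measure.volume_eq_prod, ← Measure.prod_restrict,
    lintegral_prod (fun p : ℝ × ℝ => ENNReal.ofReal p.1 * (Iio (1 : ℝ)).indicator g p.1)
      (hmeas.comp measurable_fst).aemeasurable]
  simp only [lintegral_const, Measure.restrict_apply MeasurableSet.univ, univ_inter,
    Real.volume_Ioo]
  rw [lintegral_mul_const _ hmeas, mul_comm]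
  congr 1
  · congr 1; ring
  · have : ∀ r : ℝ, ENNReal.ofReal r * (Iio (1 : ℝ)).indicator g r =
        (Iio (1 : ℝ)).indicator (fun r => ENNReal.ofReal r * g r) r := by
      intro r
      by_cases h : r ∈ Iio (1 : ℝ) <;> simp [h]
    simp_rw [this]
    rw [setLIntegral_indicator measurableSet_Iio, inter_comm, Ioi_inter_Iio]


/-! ### Transplanted monomials and their norms -/

/-- The test function `φ(w)ⁿ (w - conj z) ^ (-(α + 2))`, where `φ` is the Cayley transform at `z`:
the transplant to the half plane of the monomial of degree `n` on the disk. -/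
def bergmanMonomial (α : ℝ) (z : ℂ) (n : ℕ) (w : ℂ) : ℂ :=
  cayley z w ^ n * (w - conj z) ^ ((-(α + 2) : ℝ) : ℂ)

lemma differentiableOn_bergmanMonomial (α : ℝ) {z : ℂ} (hz : 0 < z.im) (n : ℕ) :
    DifferentiableOn ℂ (bergmanMonomial α z n) upperHalfPlaneSet := by
  intro w hw
  have hw' : 0 < w.im := hw
  have h1 : DifferentiableAt ℂ (cayley z) w := (hasDerivAt_cayley hz hw).differentiableAt
  have h2 : w - conj z ∈ Complex.slitPlane := by
    refine Or.inr ?_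
    simp only [Complex.sub_im, Complex.conj_im]
    linarith
  have h3 : DifferentiableAt ℂ (fun w => (w - conj z) ^ ((-(α + 2) : ℝ) : ℂ)) w :=
    (((hasDerivAt_id w).sub_const (conj z)).cpow_const h2).differentiableAt
  exact ((h1.pow n).mul h3).differentiableWithinAt

lemma norm_bergmanMonomial (α : ℝ) (z w : ℂ) (n : ℕ) :
    ‖bergmanMonomial α z n w‖ = ‖cayley z w‖ ^ n * ‖w - conj z‖ ^ (-(α + 2)) := by
  rw [bergmanMonomial, norm_mul, norm_pow,
    Complex.norm_cpow_real]

/-- The exponent α + 2 is chosen so that |w - conj z|^(-2(α+2)) supplies both the Jacobian |φ'|²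
(power -4) and the disk weight (power -2α). -/
lemma norm_bergmanMonomial_sq_mul (α : ℝ) {z w : ℂ} (hz : 0 < z.im) (hw : 0 < w.im) (n : ℕ) :
    ‖bergmanMonomial α z n w‖ ^ 2 * w.im ^ α =
      1 / ((4 * z.im) ^ α * (4 * z.im ^ 2)) * (‖(z - conj z) / (w - conj z) ^ 2‖ ^ 2 *
        ((‖cayley z w‖ ^ 2) ^ n * (1 - ‖cayley z w‖ ^ 2) ^ α)) := by
  have hD : 0 < ‖w - conj z‖ := norm_pos_iff.2 (sub_conj_ne_zero hz hw)
  have hzz : ‖z - conj z‖ ^ 2 = 4 * z.im ^ 2 := by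
    have := normSq_sub_conj z z
    simp only [sub_self, norm_zero] at this
    rw [this]; ring
  rw [norm_bergmanMonomial, one_sub_norm_cayley_sq hz hw, norm_div, norm_pow, div_pow, hzz,
    Real.div_rpow (by positivity) (by positivity), Real.mul_rpow (by positivity) hw.le,
    ← Real.rpow_natCast_mul hD.le, Real.rpow_neg hD.le, Real.rpow_add hD, mul_pow, inv_pow,
    mul_pow, ← Real.rpow_mul_natCast hD.le α 2, mul_comm ((2 : ℕ) : ℝ) α]
  have h2 : ‖w - conj z‖ ^ (2 : ℝ) = ‖w - conj z‖ ^ 2 := by norm_cast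
  rw [h2]
  have : (4 * z.im) ^ α ≠ 0 := by positivity
  field_simp
  ring

lemma bergmanNormSq_bergmanMonomial (α : ℝ) {z : ℂ} (hz : 0 < z.im) (n : ℕ) :
    bergmanNormSq α (bergmanMonomial α z n) =
      ENNReal.ofReal (1 / ((4 * z.im) ^ α * (4 * z.im ^ 2))) *
        (ENNReal.ofReal (2 * Real.pi) * radialMoment α n) := by
  set g : ℝ → ENNReal := fun r => ENNReal.ofReal ((r ^ 2) ^ n * (1 - r ^ 2) ^ α) with hg
  have hgm : Measurable g := by fun_prop
  have h1 : radialMoment α n = ∫⁻ r in Ioo (0 : ℝ) 1, ENNReal.ofReal r * g r :=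
    setLIntegral_congr_fun measurableSet_Ioo fun r hr => ENNReal.ofReal_mul hr.1.le
  rw [h1, ← lintegral_ball_norm hgm, ← lintegral_comp_cayley hz (fun ζ => g ‖ζ‖),
    ← lintegral_const_mul' _ _ ENNReal.ofReal_ne_top]
  refine setLIntegral_congr_fun isOpen_upperHalfPlaneSet.measurableSet fun w hw => ?_
  simp only [hg]
  rw [norm_bergmanMonomial_sq_mul α hz hw, ENNReal.ofReal_mul (by positivity),
    ENNReal.ofReal_mul (by positivity)]

lemma memBergman_bergmanMonomial {α : ℝ} (hα : 0 < α) {z : ℂ} (hz : 0 < z.im) (n : ℕ) :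
    MemBergman α (bergmanMonomial α z n) where
  holomorphic := differentiableOn_bergmanMonomial α hz n
  norm_lt_top := by
    rw [bergmanNormSq_bergmanMonomial α hz]
    exact ENNReal.mul_lt_top ENNReal.ofReal_lt_top
      (ENNReal.mul_lt_top ENNReal.ofReal_lt_top (radialMoment_lt_top hα n))

/-! ### Consequences of a gap -/

lemma weightedIntegral_bergmanMonomial_ge (α : ℝ) {μ : Measure ℂ} {z : ℂ} {R : ℝ}
    (hR : 0 ≤ R) (hgap : μ (pseudoHypDisk z R) = 0) (n : ℕ) :
    ENNReal.ofReal ((R ^ 2) ^ n) * weightedIntegral α μ (bergmanMonomial α z 0) ≤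
      weightedIntegral α μ (bergmanMonomial α z n) := by
  rw [weightedIntegral, weightedIntegral, ← lintegral_const_mul' _ _ ENNReal.ofReal_ne_top]
  apply lintegral_mono_ae
  rw [ae_restrict_iff' isOpen_upperHalfPlaneSet.measurableSet]
  filter_upwards [measure_eq_zero_iff_ae_notMem.1 hgap] with w hw hwu
  have hRw : R ≤ ‖cayley z w‖ := by
    rw [norm_cayley]
    exact not_lt.1 fun h => hw ⟨hwu, h⟩
  rw [← ENNReal.ofReal_mul (by positivity)]
  apply ENNReal.ofReal_le_ofReal
  rw [norm_bergmanMonomial, norm_bergmanMonomial, pow_zero, one_mul, mul_pow,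
    ← mul_assoc, ← pow_mul, ← pow_mul, mul_comm 2 n]
  gcongr

/-- The comparison of moments forced by a gap of radius `R` in a sampling measure. -/
lemma IsSamplingMeasure.radialMoment_le {α : ℝ} (hα : 0 < α) {μ : Measure ℂ} {A B : ℝ}
    (hμ : IsSamplingMeasure α μ A B) {R : ℝ} (hR : 0 ≤ R) {z : ℂ} (hz : 0 < z.im)
    (hgap : μ (pseudoHypDisk z R) = 0) (n : ℕ) :
    ENNReal.ofReal ((R ^ 2) ^ n) * (ENNReal.ofReal A * radialMoment α 0) ≤
      ENNReal.ofReal B * radialMoment α n := by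
  have hl := hμ.lower _ (memBergman_bergmanMonomial hα hz 0)
  have hu := hμ.upper _ (memBergman_bergmanMonomial hα hz n)
  have h := ((mul_le_mul_right hl (ENNReal.ofReal ((R ^ 2) ^ n))).trans
    (weightedIntegral_bergmanMonomial_ge α hR hgap n)).trans hu
  rw [bergmanNormSq_bergmanMonomial α hz, bergmanNormSq_bergmanMonomial α hz] at h
  set K := ENNReal.ofReal (1 / ((4 * z.im) ^ α * (4 * z.im ^ 2))) with hK
  set P := ENNReal.ofReal (2 * Real.pi) with hP
  have hKP0 : K * P ≠ 0 := mul_ne_zero (ENNReal.ofReal_pos.2 (by positivity)).ne'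
    (ENNReal.ofReal_pos.2 (by positivity)).ne'
  have hKPt : K * P ≠ ⊤ := ENNReal.mul_ne_top ENNReal.ofReal_ne_top ENNReal.ofReal_ne_top
  rw [← ENNReal.mul_le_mul_iff_right hKP0 hKPt]
  calc _ = ENNReal.ofReal ((R ^ 2) ^ n) *
        (ENNReal.ofReal A * (K * (P * radialMoment α 0))) := by ring
    _ ≤ _ := h
    _ = _ := by ring

lemma IsSamplingMeasure.gap_le_of_lt_one {α : ℝ} (hα : 0 < α) {μ : Measure ℂ} {A B : ℝ}
    (hμ : IsSamplingMeasure α μ A B) {R : ℝ} (hR : 0 < R) (hR1 : R < 1) {z : ℂ} (hz : 0 < z.im)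
    (hgap : μ (pseudoHypDisk z R) = 0) :
    R ≤ 1 - (1 / ((4 : ℝ) ^ (α + 1) * Real.pi) * (A / B)) ^ (1 / α) := by
  have hA := hμ.lower_pos
  have hB := hμ.upper_pos
  have hd : 0 < 1 - R := by linarith
  obtain ⟨n, hn⟩ := exists_radialMoment_le hα hR hR1
  have h := (hμ.radialMoment_le hα hR.le hz hgap n).trans (mul_le_mul_right hn (ENNReal.ofReal B))
  rw [radialMoment_zero hα, ← ENNReal.ofReal_mul hA.le, ← ENNReal.ofReal_mul (by positivity),
    ← ENNReal.ofReal_mul hB.le, ENNReal.ofReal_le_ofReal_iff (by positivity)] at h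
  have h1 : 1 / ((4 : ℝ) ^ (α + 1) * Real.pi) * (A / B) ≤ (1 - R) ^ α := by
    rw [div_mul_div_comm, one_mul, div_le_iff₀ (by positivity)]
    have hc : 0 < (R ^ 2) ^ n / (2 * (α + 1)) := by positivity
    refine le_of_mul_le_mul_left ?_ hc
    calc _ = (R ^ 2) ^ n * (A * (1 / (2 * (α + 1)))) := by ring
      _ ≤ _ := h
      _ = _ := by ring
  have h2 : (1 / ((4 : ℝ) ^ (α + 1) * Real.pi) * (A / B)) ^ (1 / α) ≤ 1 - R := by
    rw [one_div α]
    exact (Real.rpow_inv_le_iff_of_pos (by positivity) hd.le hα).2 h1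
  linarith

end BergmanSampling

end

theorem mainTheorem2 (α : ℝ) (hα : 0 < α) (μ : Measure ℂ) (A B : ℝ)
    (hμ : BergmanSampling.IsSamplingMeasure α μ A B)
    (R : ℝ) (hR : 0 < R) (z : ℂ) (hz : z ∈ upperHalfPlaneSet)
    (hgap : μ (BergmanSampling.pseudoHypDisk z R) = 0) :
    R ≤ 1 - (1 / ((4 : ℝ) ^ (α + 1) * Real.pi) * (A / B)) ^ (1 / α) := by
  rcases lt_or_ge R 1 with hR1 | hR1
  · exact hμ.gap_le_of_lt_one hα hR hR1 hz hgap
  · have hA := hμ.lower_pos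
    have hB := hμ.upper_pos
    have hc : 0 < (1 / ((4 : ℝ) ^ (α + 1) * Real.pi) * (A / B)) ^ (1 / α) := by positivity
    set c := (1 / ((4 : ℝ) ^ (α + 1) * Real.pi) * (A / B)) ^ (1 / α)
    -- If R ≥ 1, smaller disks are gaps too; the radius 1 - c/2 already violates the bound 1 - c,
    -- and 1/2 only keeps the radius positive.
    have hr1 : max (1 / 2) (1 - c / 2) < 1 := max_lt (by norm_num) (by linarith)
    have hr0 : 0 < max (1 / 2) (1 - c / 2) := lt_max_of_lt_left (by norm_num)
    have hsub : BergmanSampling.pseudoHypDisk z (max (1 / 2) (1 - c / 2)) ⊆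
        BergmanSampling.pseudoHypDisk z R :=
      fun w hw => ⟨hw.1, hw.2.trans (hr1.trans_le hR1)⟩
    have := hμ.gap_le_of_lt_one hα hr0 hr1 hz (measure_mono_null hsub hgap)
    linarith [le_max_right (1 / 2) (1 - c / 2)]
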